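/- Let $a<b<c<d<e$ be positive integers such that $\{a,b,c,d,e\}$ is a $D(4)$-quintuple, i.e. the product of any two distinct elements increased by $4$ is a perfect square. Let $x,y,X,Y,W$ be the positive integers with $$ad+4=x^2,\quad bd+4=y^2,\quad ae+4=X^2,\quad be+4=Y^2,\quad de+4=W^2 .$$ Let $\varepsilon\in\{1,-1\}$ and let $l,m$ be nonnegative integers (the indices of the solutions in the corresponding sequences of solutions of the generalized Pell equations $aW^2-dX^2=4(a-d)$ and $bW^2-dY^2=4(b-d)$) such that $$W\sqrt a+X\sqrt d=(2\varepsilon\sqrt a+2\sqrt d)\left(\frac{x+\sqrt{ad}}{2}\right)^{2l},$$ $$W\sqrt b+Y\sqrt d=(2\varepsilon\sqrt b+2\sqrt d)\left(\frac{y+\sqrt{bd}}{2}\right)^{2m}.$$ Then $2l\le 3m$, and if $m\ge 2$ then $m<l$. -/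

import Mathlib

/-- `S` is a `D(n)`-`m`-tuple: a set of `m` positive integers such that the product of any two
distinct elements, increased by `n`, is a perfect square. -/
def IsDTuple (n : ℤ) (m : ℕ) (S : Finset ℕ) : Prop :=
  S.card = m ∧ (∀ u ∈ S, 0 < u) ∧
    ∀ u ∈ S, ∀ v ∈ S, u ≠ v → IsSquare ((u : ℤ) * (v : ℤ) + n)

/-- `(U, V)` is the solution with index `N` in the sequence of solutions of the generalized Pell
equation `A U² - B V² = 4 (A - B)` that starts at `(U₀, V₀)`, where `ρ² = A B + 4`:
`U √A + V √B = (U₀ √A + V₀ √B) ((ρ + √(A B)) / 2) ^ N`. -/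
def PellSolutionAt (A B ρ : ℕ) (U₀ V₀ : ℤ) (N : ℕ) (U V : ℤ) : Prop :=
  (U : ℝ) * √(A : ℝ) + (V : ℝ) * √(B : ℝ) =
    ((U₀ : ℝ) * √(A : ℝ) + (V₀ : ℝ) * √(B : ℝ)) *
      (((ρ : ℝ) + √((A : ℝ) * (B : ℝ))) / 2) ^ N

/-! Both equations express the same `W`: it is term `2l` of the sequence for `a` and term `2m` of
the one for `b`, which start alike and grow by factors α = (x+√(ad))/2 and β = (y+√(bd))/2. The gap
`b * c < d` (`mul_lt_of_quadruple`) makes d large against b, and controls both growth rates. It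
gives β² ≤ α³, so 2l ≥ 3m+1 would make α^(2l) at least 4β^(2m), too large for the two values to
agree (`size_contradiction`). Conversely, the sequence for `b` is strictly larger from index 2 on
(`pellSeq_lt_pellSeq`), so by monotonicity l ≤ m is impossible. -/

theorem two_dvd_sub_of_triple {A B C r s t : ℤ} (hr : A * B + 4 = r ^ 2)
    (hs : A * C + 4 = s ^ 2) (ht : B * C + 4 = t ^ 2) :
    2 ∣ A * B * C - r * s * t ∧ 2 ∣ r * s - A * t ∧ 2 ∣ s * t - C * r := by
  have key : ∀ u v w r s t : ZMod 2, u * v + 4 = r ^ 2 → u * w + 4 = s ^ 2 →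
      v * w + 4 = t ^ 2 → u * v * w - r * s * t = 0 ∧ r * s - u * t = 0 := by decide
  have hr' : (A * B + 4 : ZMod 2) = r ^ 2 := by exact_mod_cast congrArg (Int.cast : ℤ → ZMod 2) hr
  have hs' : (A * C + 4 : ZMod 2) = s ^ 2 := by exact_mod_cast congrArg (Int.cast : ℤ → ZMod 2) hs
  have ht' : (B * C + 4 : ZMod 2) = t ^ 2 := by exact_mod_cast congrArg (Int.cast : ℤ → ZMod 2) ht
  refine ⟨?_, ?_, ?_⟩ <;> refine (ZMod.intCast_zmod_eq_zero_iff_dvd _ 2).1 ?_ <;> push_cast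
  · exact (key _ _ _ _ _ _ hr' hs' ht').1
  · exact (key _ _ _ _ _ _ hr' hs' ht').2
  · exact (key C A B s t r (by rwa [mul_comm]) (by rwa [mul_comm]) hr').2

theorem five_le_of_add_four_eq_sq {n u : ℤ} (hn : 0 < n) (h : n + 4 = u ^ 2) : 5 ≤ n := by
  have hu : u ^ 2 = |u| ^ 2 := (sq_abs u).symm
  have h3 : 3 ≤ |u| := by
    by_contra! h3
    nlinarith [abs_nonneg u]
  nlinarith

/-- A `D(4)`-triple is either regular or its largest element is large. -/
theorem eq_or_lt_of_triple {A B C r s t : ℤ} (hA : 0 < A) (hAB : A < B) (hBC : B < C)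
    (hC : 5 ≤ C) (hr0 : 0 ≤ r) (hs0 : 0 ≤ s) (ht0 : 0 ≤ t) (hr : A * B + 4 = r ^ 2)
    (hs : A * C + 4 = s ^ 2) (ht : B * C + 4 = t ^ 2) :
    C = A + B + 2 * r ∨ (A * B < C ∧ 5 * B < C) := by
  obtain ⟨⟨k, hk⟩, ⟨p, hp⟩, ⟨q, hq⟩⟩ := two_dvd_sub_of_triple hr hs ht
  -- `f` is the smaller regular extension A+B+C+(ABC-rst)/2 of the triple. Its product with the
  -- conjugate (+rst) is (C-A-B)²-4r², so `f = 0` is the regular case and `f > 0` forces `f * A * B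
  -- < C`.
  obtain ⟨f, hf⟩ : ∃ f : ℤ, f = A + B + C + k := ⟨_, rfl⟩
  have hAf : A * f + 4 = p ^ 2 := by
    have : (r * s - A * t) ^ 2 = 4 * (A * f + 4) := by
      have e : (r * s - A * t) ^ 2 = r ^ 2 * s ^ 2 + A ^ 2 * t ^ 2 - 2 * A * (r * s * t) := by ring
      rw [e, ← hr, ← hs, ← ht, hf]
      linear_combination 2 * A * hk
    rw [hp] at this
    linarith
  have hCf : C * f + 4 = q ^ 2 := by
    have : (s * t - C * r) ^ 2 = 4 * (C * f + 4) := by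
      have e : (s * t - C * r) ^ 2 = s ^ 2 * t ^ 2 + C ^ 2 * r ^ 2 - 2 * C * (r * s * t) := by ring
      rw [e, ← hr, ← hs, ← ht, hf]
      linear_combination 2 * C * hk
    rw [hq] at this
    linarith
  have hf0 : 0 ≤ f := by
    by_contra! h
    nlinarith [sq_nonneg q]
  have hprod : f * (A + B + C + A * B * C - k) = (C - A - B) ^ 2 - 4 * r ^ 2 := by
    have e : (r * s * t) ^ 2 = (A * B + 4) * (A * C + 4) * (B * C + 4) := by
      rw [hr, hs, ht]; ring
    have e2 : r * s * t = A * B * C - 2 * k := by linarith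
    rw [e2] at e
    have e4 : 4 * (f * (A + B + C + A * B * C - k)) = 4 * ((C - A - B) ^ 2 - 4 * r ^ 2) := by
      rw [hf, ← hr]
      linear_combination -e
    linarith
  rcases hf0.eq_or_lt with h0 | h0
  · left
    rw [← h0, zero_mul] at hprod
    have : (C - A - B - 2 * r) * (C - A - B + 2 * r) = 0 := by linarith
    rcases mul_eq_zero.1 this with h | h
    · linarith
    · nlinarith
  · right
    have h5 := five_le_of_add_four_eq_sq (mul_pos hA h0) hAf
    have hB : 0 < B := hA.trans hAB
    have hC0 : 0 < C := hB.trans hBC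
    have hk0 : k ≤ 0 := by
      by_contra! h
      have h1 : (r * s * t) ^ 2 < (A * B * C) ^ 2 :=
        pow_lt_pow_left₀ (by linarith) (by positivity) (by norm_num)
      have h2 : (r * s * t) ^ 2 = (A * B + 4) * (A * C + 4) * (B * C + 4) := by
        rw [hr, hs, ht]; ring
      have h3 : (A * B) * (A * C) * (B * C) ≤ (A * B + 4) * (A * C + 4) * (B * C + 4) := by
        gcongr <;> linarith
      linarith
    have hlt : f * (A * B * C) < f * (A + B + C + A * B * C - k) :=
      mul_lt_mul_of_pos_left (by linarith) h0
    have hle : (C - A - B) ^ 2 ≤ C ^ 2 := by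
      have : 0 ≤ (A + B) * (2 * C - A - B) := mul_nonneg (by linarith) (by linarith)
      linarith
    have hlt' : f * (A * B) < C := by
      by_contra! h
      have := mul_le_mul_of_nonneg_right h hC0.le
      linarith [sq_nonneg r]
    have h6 : 5 * B ≤ A * f * B := mul_le_mul_of_nonneg_right h5 hB.le
    have h7 : A * B ≤ f * (A * B) := le_mul_of_one_le_left (by positivity) h0
    constructor <;> linarith

/-- If {b,c,d} is regular, then d = b+c+2t < 4c because t ≤ c. So {a,c,d} must be regular too,
giving d = a+c+2s, which is smaller since a < b and s < t. -/
theorem mul_lt_of_quadruple {a b c d s t x y z : ℤ} (ha : 0 < a) (hab : a < b) (hbc : b < c)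
    (hcd : c < d) (hc : 5 ≤ c) (hs0 : 0 ≤ s) (ht0 : 0 ≤ t) (hx0 : 0 ≤ x) (hy0 : 0 ≤ y)
    (hz0 : 0 ≤ z) (hs : a * c + 4 = s ^ 2) (ht : b * c + 4 = t ^ 2)
    (hx : a * d + 4 = x ^ 2) (hy : b * d + 4 = y ^ 2) (hz : c * d + 4 = z ^ 2) : b * c < d := by
  rcases eq_or_lt_of_triple (ha.trans hab) hbc hcd (by linarith) ht0 hy0 hz0 ht hy hz with h | h
  · have hst : s < t := by nlinarith
    have htc : t ≤ c := by nlinarith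
    rcases eq_or_lt_of_triple ha (hab.trans hbc) hcd (by linarith) hs0 hx0 hz0 hs hx hz with h' | h'
    · linarith
    · linarith
  · exact h.1

/-- The first components of the solutions of `A U² - B V² = 4 (A - B)` that start at `(2 ε, 2)`. -/
def pellSeq (x d ε : ℤ) : ℕ → ℤ
  | 0 => 2 * ε
  | 1 => d + ε * x
  | n + 2 => x * pellSeq x d ε (n + 1) - pellSeq x d ε n

theorem pellSeq_mul_sqrt {a d x : ℕ} (hx : a * d + 4 = x ^ 2) (ε : ℤ) (n : ℕ) :
    (pellSeq x d ε n : ℝ) * √a =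
      (√d + ε * √a) * ((x + √((a : ℝ) * d)) / 2) ^ n -
        (√d - ε * √a) * ((x - √((a : ℝ) * d)) / 2) ^ n := by
  have hsq : √((a : ℝ) * d) ^ 2 = (x : ℝ) ^ 2 - 4 := by
    rw [Real.sq_sqrt (by positivity), ← Nat.cast_pow, ← hx]
    push_cast; ring
  induction n using Nat.twoStepInduction with
  | zero => simp only [pellSeq, pow_zero]; push_cast; ring
  | one =>
    have e : √((a : ℝ) * d) = √a * √d := Real.sqrt_mul (by positivity) _
    have ed : √(d : ℝ) ^ 2 = d := Real.sq_sqrt (by positivity)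
    simp only [pellSeq, pow_one, e]
    push_cast
    linear_combination -√(a : ℝ) * ed
  | more n h0 h1 =>
    simp only [pellSeq]
    push_cast
    rw [sub_mul, mul_assoc, h1, h0]
    simp only [pow_succ]
    linear_combination (-(1 / 4 : ℝ) * (√d + ε * √a) * ((x + √((a : ℝ) * d)) / 2) ^ n +
      (1 / 4 : ℝ) * (√d - ε * √a) * ((x - √((a : ℝ) * d)) / 2) ^ n) * hsq

theorem half_add_mul_half_sub {a d x : ℕ} (hx : a * d + 4 = x ^ 2) :
    ((x + √((a : ℝ) * d)) / 2) * ((x - √((a : ℝ) * d)) / 2) = 1 := by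
  have hsq : √((a : ℝ) * d) ^ 2 = (x : ℝ) ^ 2 - 4 := by
    rw [Real.sq_sqrt (by positivity), ← Nat.cast_pow, ← hx]
    push_cast; ring
  linear_combination -(1 / 4 : ℝ) * hsq

/-- Eliminating e gives aW²-dX² = 4(a-d), also the norm of the starting value. Dividing by the given
equation yields its conjugate, and averaging the two removes X. -/
theorem PellSolutionAt.eq_pellSeq {a d e x X W : ℕ} (ha : 0 < a) (had : a < d)
    (hx : a * d + 4 = x ^ 2) (hX : a * e + 4 = X ^ 2) (hW : d * e + 4 = W ^ 2) {ε : ℤ}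
    (hε : ε = 1 ∨ ε = -1) {n : ℕ} (h : PellSolutionAt a d x (2 * ε) 2 n W X) :
    (W : ℤ) = pellSeq x d ε n := by
  unfold PellSolutionAt at h
  have hf := pellSeq_mul_sqrt hx ε n
  have hαα : ((x + √((a : ℝ) * d)) / 2) ^ n * ((x - √((a : ℝ) * d)) / 2) ^ n = 1 := by
    rw [← mul_pow, half_add_mul_half_sub hx, one_pow]
  have hα : 0 < ((x + √((a : ℝ) * d)) / 2) ^ n := by
    have : 0 < √((a : ℝ) * d) := Real.sqrt_pos.2 (by have := ha.trans had; positivity)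
    positivity
  push_cast at h
  generalize ((x + √((a : ℝ) * d)) / 2) ^ n = P at *
  generalize ((x - √((a : ℝ) * d)) / 2) ^ n = P' at *
  have ea : √(a : ℝ) ^ 2 = a := Real.sq_sqrt (by positivity)
  have ed : √(d : ℝ) ^ 2 = d := Real.sq_sqrt (by positivity)
  have hsa : 0 < √(a : ℝ) := Real.sqrt_pos.2 (by positivity)
  have hsad : √(a : ℝ) < √d := Real.sqrt_lt_sqrt (by positivity) (by exact_mod_cast had)
  have hX' : (a : ℝ) * e + 4 = X ^ 2 := by exact_mod_cast hX
  have hW' : (d : ℝ) * e + 4 = W ^ 2 := by exact_mod_cast hW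
  have hε2 : (ε : ℝ) ^ 2 = 1 := by rcases hε with rfl | rfl <;> norm_num
  have hpos : 0 < 2 * (ε : ℝ) * √a + 2 * √d := by
    rcases hε with rfl | rfl <;> push_cast <;> linarith
  have hconj : (W : ℝ) * √a - X * √d = (2 * ε * √a - 2 * √d) * P' := by
    have hnorm : ((W : ℝ) * √a + X * √d) * (W * √a - X * √d) = 4 * (a - d) := by
      linear_combination (W : ℝ) ^ 2 * ea - (X : ℝ) ^ 2 * ed - (a : ℝ) * hW' + (d : ℝ) * hX'
    have h4 : (2 * (ε : ℝ) * √a + 2 * √d) * (2 * ε * √a - 2 * √d) = 4 * (a - d) := by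
      linear_combination 4 * (ε : ℝ) ^ 2 * ea - 4 * ed + 4 * (a : ℝ) * hε2
    have hne : (2 * (ε : ℝ) * √a + 2 * √d) * P ≠ 0 := (mul_pos hpos hα).ne'
    apply mul_left_cancel₀ hne
    rw [h] at hnorm
    linear_combination hnorm - h4 -
      (2 * (ε : ℝ) * √a + 2 * √d) * (2 * ε * √a - 2 * √d) * hαα
  have : (W : ℝ) = (pellSeq x d ε n : ℝ) := by
    apply mul_right_cancel₀ hsa.ne'
    linear_combination (1 / 2 : ℝ) * h + (1 / 2 : ℝ) * hconj - hf
  exact_mod_cast this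

theorem pellSeq_mono {x d ε : ℤ} (hx : 2 ≤ x) (hxd : x + 2 ≤ d) (hε : ε = 1 ∨ ε = -1) :
    Monotone (pellSeq x d ε) := by
  have key : ∀ n, 0 ≤ pellSeq x d ε (n + 1) ∧ pellSeq x d ε n ≤ pellSeq x d ε (n + 1) := by
    intro n
    induction n with
    | zero => rcases hε with rfl | rfl <;> simp only [pellSeq] <;> constructor <;> linarith
    | succ n ih =>
      have : pellSeq x d ε (n + 2) = x * pellSeq x d ε (n + 1) - pellSeq x d ε n := rfl
      constructor <;> nlinarith
  exact monotone_nat_of_le_succ fun n => (key n).2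

/-- The difference of the sequences is nondecreasing from index 1. At index 2 it is d((y-x)+ε(b-a)),
positive even for ε = -1 because (y-x)(x+y) = (b-a)d with x+y < d. Index 1 would fail for ε = -1. -/
theorem pellSeq_lt_pellSeq {a b d x y ε : ℤ} (hab : a < b) (hxy : x < y) (hx2 : 2 ≤ x)
    (hd : x + y < d) (hx : a * d + 4 = x ^ 2) (hy : b * d + 4 = y ^ 2) (hε : ε = 1 ∨ ε = -1)
    (n : ℕ) : pellSeq x d ε (n + 2) < pellSeq y d ε (n + 2) := by
  have hmono := pellSeq_mono hx2 (by linarith) hε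
  have hpos : ∀ n, 0 ≤ pellSeq x d ε (n + 1) := fun n =>
    le_trans (by rcases hε with rfl | rfl <;> simp only [pellSeq] <;> linarith)
      (hmono (Nat.le_add_left 1 n))
  have hgap : b - a < y - x := by
    have : (y - x) * (x + y) = (b - a) * d := by linarith
    by_contra! h
    nlinarith
  have hd0 : 0 < d := by linarith
  have key : ∀ n, pellSeq x d ε (n + 2) < pellSeq y d ε (n + 2) ∧
      pellSeq y d ε (n + 1) - pellSeq x d ε (n + 1) ≤
        pellSeq y d ε (n + 2) - pellSeq x d ε (n + 2) := by
    intro n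
    induction n with
    | zero =>
      have h1 := mul_lt_mul_of_pos_left hgap hd0
      have h2 := mul_lt_mul_of_pos_left hab hd0
      rcases hε with rfl | rfl <;> simp only [pellSeq] <;> constructor <;> nlinarith
    | succ n ih =>
      have e1 : pellSeq x d ε (n + 3) = x * pellSeq x d ε (n + 2) - pellSeq x d ε (n + 1) := rfl
      have e2 : pellSeq y d ε (n + 3) = y * pellSeq y d ε (n + 2) - pellSeq y d ε (n + 1) := rfl
      have h := hpos (n + 1)
      have h1 : x * pellSeq x d ε (n + 2) + 2 * (pellSeq y d ε (n + 2) - pellSeq x d ε (n + 2)) ≤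
          y * pellSeq y d ε (n + 2) := by
        nlinarith [ih.1]
      constructor <;> linarith [ih.1, ih.2]
  exact (key n).1

/-- The hypothesis reads β²+β⁻² ≤ α³+α⁻³, and t+1/t is increasing for t ≥ 1. -/
theorem pow_three_ge_pow_two_of_add_inv {α α' β β' x y : ℝ} (hα : 1 ≤ α) (hβ : 1 ≤ β)
    (hα' : α * α' = 1) (hβ' : β * β' = 1) (hx : α + α' = x) (hy : β + β' = y)
    (h : y ^ 2 - 2 ≤ x ^ 3 - 3 * x) : β ^ 2 ≤ α ^ 3 := by
  have e1 : x ^ 3 - 3 * x = α ^ 3 + α' ^ 3 := by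
    rw [← hx]; linear_combination 3 * (α + α') * hα'
  have e2 : y ^ 2 - 2 = β ^ 2 + β' ^ 2 := by
    rw [← hy]; linear_combination 2 * hβ'
  have m1 : α ^ 3 * α' ^ 3 = 1 := by rw [← mul_pow, hα', one_pow]
  have m2 : β ^ 2 * β' ^ 2 = 1 := by rw [← mul_pow, hβ', one_pow]
  rw [e1, e2] at h
  have p1 : 1 ≤ α ^ 3 := one_le_pow₀ hα
  have p2 : 1 ≤ β ^ 2 := one_le_pow₀ hβ
  generalize α ^ 3 = p at *
  generalize α' ^ 3 = p' at *
  generalize β ^ 2 = q at *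
  generalize β' ^ 2 = q' at *
  by_contra! hlt
  have : 0 < (q - p) * (p * q - 1) := mul_pos (by linarith) (by nlinarith)
  have e : (q - p) * (p * q - 1) = p * q * ((q + q') - (p + p')) := by
    linear_combination -p * m2 + q * m1
  have : p * q * ((q + q') - (p + p')) ≤ 0 :=
    mul_nonpos_of_nonneg_of_nonpos (by positivity) (by linarith)
  linarith

/-- Here A, B, D stand for √a, √b, √d. Computing wAB both ways, the term 4BDQ outweighs ADQ and all
the rest. -/
theorem size_contradiction {A B D P P' Q Q' w ε : ℝ} (hA : 0 < A) (hAB : A < B) (hBD : 2 * B ≤ D)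
    (hε : ε = 1 ∨ ε = -1) (hQ : 1 ≤ Q) (hPQ : 4 * Q ≤ P) (hP' : P * P' = 1) (hQ' : Q * Q' = 1)
    (h1 : w * A = (D + ε * A) * P - (D - ε * A) * P')
    (h2 : w * B = (D + ε * B) * Q - (D - ε * B) * Q') : False := by
  have hQ'0 : 0 < Q' := by by_contra! h; nlinarith
  have hP'0 : 0 < P' := by by_contra! h; nlinarith
  have hP'4 : P' ≤ 1 / 4 := by nlinarith
  have hB : 0 < B := hA.trans hAB
  have hD : 0 < D := by linarith
  have hle : w * B ≤ (D + ε * B) * Q := by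
    have : 0 ≤ (D - ε * B) * Q' :=
      mul_nonneg (by rcases hε with rfl | rfl <;> linarith) hQ'0.le
    linarith
  have hge : (D + ε * A) * (4 * Q) - (D - ε * A) * (1 / 4) ≤ w * A := by
    rw [h1]
    have i1 : (D + ε * A) * (4 * Q) ≤ (D + ε * A) * P :=
      mul_le_mul_of_nonneg_left hPQ (by rcases hε with rfl | rfl <;> linarith)
    have i2 : (D - ε * A) * P' ≤ (D - ε * A) * (1 / 4) :=
      mul_le_mul_of_nonneg_left hP'4 (by rcases hε with rfl | rfl <;> linarith)
    linarith
  have j1 := mul_le_mul_of_nonneg_left hle hA.le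
  have j2 := mul_le_mul_of_nonneg_left hge hB.le
  have j3 : B * ((D + ε * A) * (4 * Q) - (D - ε * A) * (1 / 4)) ≤ A * ((D + ε * B) * Q) := by
    linarith
  have k1 : A * D * Q ≤ B * D * Q := by gcongr
  have k2 : B * D ≤ B * D * Q := le_mul_of_one_le_right (by positivity) hQ
  have k3 : 2 * (A * B * Q) ≤ B * D * Q := by
    have : 2 * A * (B * Q) ≤ D * (B * Q) :=
      mul_le_mul_of_nonneg_right (by linarith) (by positivity)
    linarith
  have k4 : A * B ≤ A * B * Q := le_mul_of_one_le_right (by positivity) hQ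
  have k5 : 0 < A * B := by positivity
  have k6 : 0 < B * D := by positivity
  rcases hε with rfl | rfl <;> nlinarith

theorem half_add_sqrt_lower {a d x : ℕ} (h : 16 ≤ a * d) (hx : a * d + 4 = x ^ 2) :
    4 ≤ ((x : ℝ) + √((a : ℝ) * d)) / 2 := by
  have h1 : (4 : ℝ) ≤ √((a : ℝ) * d) := Real.le_sqrt_of_sq_le (by exact_mod_cast (by omega))
  have h2 : 4 ≤ x := by nlinarith
  have h3 : (4 : ℝ) ≤ x := by exact_mod_cast h2
  linarith

theorem IsDTuple.exists_sq {S : Finset ℕ} {k : ℕ} (h : IsDTuple 4 k S) {u v : ℕ} (hu : u ∈ S)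
    (hv : v ∈ S) (huv : u ≠ v) : ∃ r : ℤ, 0 ≤ r ∧ (u : ℤ) * v + 4 = r ^ 2 := by
  obtain ⟨r, hr⟩ := h.2.2 u hu v hv huv
  exact ⟨|r|, abs_nonneg r, by rw [hr, sq_abs, sq]⟩

theorem mainTheorem9 (a b c d e : ℕ)
    (hab : a < b) (hbc : b < c) (hcd : c < d) (hde : d < e)
    (hquint : IsDTuple 4 5 {a, b, c, d, e})
    (x y X Y W : ℕ)
    (hx : a * d + 4 = x ^ 2) (hy : b * d + 4 = y ^ 2)
    (hX : a * e + 4 = X ^ 2) (hY : b * e + 4 = Y ^ 2) (hW : d * e + 4 = W ^ 2)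
    (ε : ℤ) (hε : ε = 1 ∨ ε = -1) (l m : ℕ)
    (hl : PellSolutionAt a d x (2 * ε) 2 (2 * l) W X)
    (hm : PellSolutionAt b d y (2 * ε) 2 (2 * m) W Y) :
    2 * l ≤ 3 * m ∧ (2 ≤ m → m < l) := by
  have ha : 0 < a := hquint.2.1 a (by simp)
  obtain ⟨r, hr0, hr⟩ := hquint.exists_sq (u := a) (v := b) (by simp) (by simp) (by omega)
  obtain ⟨s, hs0, hs⟩ := hquint.exists_sq (u := a) (v := c) (by simp) (by simp) (by omega)
  obtain ⟨t, ht0, ht⟩ := hquint.exists_sq (u := b) (v := c) (by simp) (by simp) (by omega)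
  obtain ⟨z, hz0, hz⟩ := hquint.exists_sq (u := c) (v := d) (by simp) (by simp) (by omega)
  -- This gives c ≥ 5, hence 5b < d.
  have hb4 : 4 ≤ b := by
    have h5 := five_le_of_add_four_eq_sq (by have := ha.trans hab; positivity) hr
    have hb3 : 3 ≤ b := by
      by_contra! h
      obtain rfl : a = 1 := by omega
      omega
    by_contra! h
    have hb : b = 3 := by omega
    have ha' : a = 1 ∨ a = 2 := by omega
    subst hb
    rcases ha' with rfl | rfl
    · norm_num at h5
    · norm_num at hr
      have : r < 4 := by nlinarith
      have : 3 < r := by nlinarith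
      omega
  have hxZ : (a : ℤ) * d + 4 = (x : ℤ) ^ 2 := by exact_mod_cast hx
  have hyZ : (b : ℤ) * d + 4 = (y : ℤ) ^ 2 := by exact_mod_cast hy
  have hbcd : b * c < d := by
    have := mul_lt_of_quadruple (a := a) (b := b) (c := c) (d := d) (by omega) (by omega)
      (by omega) (by omega) (by omega) hs0 ht0 (Int.natCast_nonneg x) (Int.natCast_nonneg y) hz0 hs ht
      hxZ hyZ hz
    exact_mod_cast this
  have h5b : 5 * b < d := (Nat.mul_le_mul_right b (show 5 ≤ c by omega)).trans_lt
    (by rwa [mul_comm])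
  have hda : d ≤ a * d := Nat.le_mul_of_pos_left d ha
  have hdb : a * d < b * d := Nat.mul_lt_mul_of_pos_right hab (by omega)
  have hx2 : 2 ≤ x := by
    by_contra! h
    have := Nat.pow_le_pow_left h.le 2
    omega
  have hxy : x < y := lt_of_pow_lt_pow_left₀ 2 (by omega) (by omega)
  have hyd : 2 * y ≤ d := by
    by_contra! h
    have h1 := Nat.pow_lt_pow_left h (by norm_num : 2 ≠ 0)
    have h2 := Nat.mul_le_mul_right d h5b
    nlinarith
  have hWl := hl.eq_pellSeq ha (by omega) hx hX hW hε
  have hWm := hm.eq_pellSeq (by omega) (by omega) hy hY hW hε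
  have hm1 : 1 ≤ m := by
    by_contra! h
    obtain rfl : m = 0 := by omega
    have : (W : ℤ) ≤ 2 := by rcases hε with rfl | rfl <;> simp only [pellSeq] at hWm <;> omega
    have hW2 : W ≤ 2 := by exact_mod_cast this
    have h4 := Nat.pow_le_pow_left hW2 2
    have h0 := Nat.mul_pos (show 0 < d by omega) (show 0 < e by omega)
    omega
  constructor
  · by_contra! hlm
    have hα4 := half_add_sqrt_lower (by omega) hx
    have hβ4 := half_add_sqrt_lower (by omega) hy
    have hαα := half_add_mul_half_sub hx
    have hββ := half_add_mul_half_sub hy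
    have hfa := pellSeq_mul_sqrt hx ε (2 * l)
    have hfb := pellSeq_mul_sqrt hy ε (2 * m)
    rw [← hWl] at hfa
    rw [← hWm] at hfb
    -- b² ≤ bc < d < x². Then bd+2 ≤ x(ad+1), which is y²-2 ≤ x³-3x.
    have hax : b ≤ a * x := by
      by_contra! h
      have h1 : (a * x) ^ 2 < b ^ 2 := Nat.pow_lt_pow_left h (by norm_num)
      have h2 : x ^ 2 ≤ (a * x) ^ 2 := Nat.pow_le_pow_left (Nat.le_mul_of_pos_left x ha) 2
      have h3 : b ^ 2 ≤ b * c := by rw [sq]; exact Nat.mul_le_mul_left b hbc.le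
      omega
    have hxyR : (y : ℝ) ^ 2 - 2 ≤ (x : ℝ) ^ 3 - 3 * x := by
      have h1 : b * d + 2 ≤ x * (a * d + 1) := by
        linarith [Nat.mul_le_mul_right d hax]
      have h1' : (b : ℝ) * d + 2 ≤ x * (a * d + 1) := by exact_mod_cast h1
      have hx' : (a : ℝ) * d + 4 = x ^ 2 := by exact_mod_cast hx
      have hy' : (b : ℝ) * d + 4 = y ^ 2 := by exact_mod_cast hy
      rw [← hy']
      have : (x : ℝ) ^ 3 - 3 * x = x * (a * d + 1) := by linear_combination -(x : ℝ) * hx'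
      linarith
    have h32 := pow_three_ge_pow_two_of_add_inv (by linarith) (by linarith) hαα hββ
      (show _ = (x : ℝ) by ring) (show _ = (y : ℝ) by ring) hxyR
    have hPP : ((x + √((a : ℝ) * d)) / 2) ^ (2 * l) * ((x - √((a : ℝ) * d)) / 2) ^ (2 * l) = 1 := by
      rw [← mul_pow, hαα, one_pow]
    have hQQ : ((y + √((b : ℝ) * d)) / 2) ^ (2 * m) * ((y - √((b : ℝ) * d)) / 2) ^ (2 * m) = 1 := by
      rw [← mul_pow, hββ, one_pow]
    -- The factor 4 is the one spare α in α^(3m+1).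
    have hPQ : 4 * ((y + √((b : ℝ) * d)) / 2) ^ (2 * m) ≤ ((x + √((a : ℝ) * d)) / 2) ^ (2 * l) := by
      calc 4 * ((y + √((b : ℝ) * d)) / 2) ^ (2 * m)
          ≤ ((x + √((a : ℝ) * d)) / 2) * (((x + √((a : ℝ) * d)) / 2) ^ 3) ^ m := by
            rw [pow_mul]
            gcongr
        _ = ((x + √((a : ℝ) * d)) / 2) ^ (3 * m + 1) := by
            rw [← pow_mul, ← pow_succ']
        _ ≤ _ := pow_le_pow_right₀ (by linarith) hlm
    have hQ1 : 1 ≤ ((y + √((b : ℝ) * d)) / 2) ^ (2 * m) := one_le_pow₀ (by linarith)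
    have hsb : 2 * √(b : ℝ) ≤ √d := by
      apply Real.le_sqrt_of_sq_le
      rw [mul_pow, Real.sq_sqrt (by positivity)]
      exact_mod_cast (by omega : 2 ^ 2 * b ≤ d)
    exact size_contradiction (Real.sqrt_pos.2 (by positivity))
      (Real.sqrt_lt_sqrt (by positivity) (by exact_mod_cast hab)) hsb
      (ε := (ε : ℝ)) (by rcases hε with rfl | rfl <;> simp) hQ1 hPQ hPP hQQ
      (w := ((W : ℤ) : ℝ)) hfa hfb
  · intro _
    by_contra! hlm
    obtain ⟨k, rfl⟩ : ∃ k, m = k + 1 := ⟨m - 1, by omega⟩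
    have h1 := pellSeq_mono (x := x) (d := d) (by omega) (by omega) hε
      (show 2 * l ≤ 2 * (k + 1) by omega)
    have h2 := pellSeq_lt_pellSeq (a := a) (b := b) (d := d) (x := x) (y := y) (by omega) (by omega)
      (by omega) (by omega) hxZ hyZ hε (2 * k)
    rw [show 2 * (k + 1) = 2 * k + 2 by ring] at *
    omega
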